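/- **Theorem.** Conventions. For a set $X\subset\mathbb{R}^n$ the packing radius $r_X$ is half the infimum of the distances between distinct points of $X$, and the covering radius $R_X$ is the supremum over $c\in\mathbb{R}^n$ of the distance from $c$ to $X$. $X$ is a *Delone set* if $r_X>0$ and $R_X<\infty$, and a *Meyer set* if both $X$ and $X-X$ are Delone sets. $X$ is *aperiodic* if $X+t=X$ only for $t=0$. The $T$-patch of $X$ at $x\in X$ is $\mathcal P_X(x;T)=X\cap B(x;T)$ ($B$ the open ball); the patches at $x$ and $y$ are equivalent if $\mathcal P_X(y;T)=\mathcal P_X(x;T)+y-x$. $N_X(T)$ is the number (possibly infinite) of equivalence classes of $T$-patches centered at points of $X$, and $M_X(T)$ is the least $M$ (possibly infinite) such that every closed ball of radius $M$ contains, for each $T$-patch of $X$, the center of an equivalent $T$-patch of $X$. $X$ is *repetitive* if $M_X(T)<\infty$ for all $T>0$. $X$ has *uniform patch frequencies* if for every $T>0$ and $x\in X$ there is a number $f$ such that, as $L\to\infty$, the number of $y\in X\cap B(c;L)$ whose $T$-patch is equivalent to that of $x$, divided by $\operatorname{vol}B(c;L)$, tends to $f$ uniformly in $c\in\mathbb{R}^n$.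 Let $\kappa(n)$ be the infimum of $R_X/r_X$ over all Delone sets $X\subset\mathbb{R}^n$, and $\kappa_L(n)$ the infimum of $R_\Lambda/r_\Lambda$ over all full rank lattices $\Lambda\subset\mathbb{R}^n$. Let $n\ge 1$ and $\varepsilon>0$. (i) There exists an aperiodic Delone set $X\subset\mathbb{R}^n$ for which there is a $T>0$ such that $$N_X(T)<\Bigl(\tfrac12\kappa(n)+\varepsilon\Bigr)\frac{T}{R_X}\quad\text{and}\quad M_X(T)<\Bigl(\tfrac12\kappa(n)+\varepsilon\Bigr)T.$$ (ii) There exists an aperiodic repetitive Meyer set $Z\subset\mathbb{R}^n$ having uniform patch frequencies for which there is a $T>0$ such that $$N_Z(T)<\Bigl(\tfrac12\kappa_L(n)+\varepsilon\Bigr)\frac{T}{R_Z}\quad\text{and}\quad M_Z(T)<\Bigl(\tfrac12\kappa_L(n)+\varepsilon\Bigr)T.$$ Moreover $Z$ can be taken to be a perturbed lattice, i.e. $Z=\{\lambda+\langle\phi(\lambda)\rangle\delta:\lambda\in\Lambda\}$ for a full rank lattice $\Lambda$, a linear functional $\phi$ on $\mathbb{R}^n$ and a vector $\delta\in\mathbb{R}^n$,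 where $\langle t\rangle=t-\lfloor t\rfloor$, and at the same time a cut-and-project set: there are a full rank lattice $L\subset\mathbb{R}^n\times\mathbb{R}$, projecting injectively to $\mathbb{R}^n$ and onto a dense subset of $\mathbb{R}$, and an interval $[a,b)$ with $a<b$ such that $Z=\{x:(x,s)\in L,\ s\in[a,b)\}$. -/

import Mathlib

open scoped ENNReal

namespace Delone

noncomputable section

section Metric

variable {E : Type*} [NormedAddCommGroup E]

/-- The packing radius `r` of a point set: half of the infimum of the distances between distinct
points, i.e. the largest `r` such that the open balls of radius `r` about the points are disjoint. -/
def packingRadius (X : Set E) : ℝ≥0∞ := X.einfsep / 2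

/-- The covering radius `R` of a point set: the supremum over all points of space of the
distance to the set, i.e. the least radius of closed balls about the points that cover space. -/
def coveringRadius (X : Set E) : ℝ≥0∞ := ⨆ c : E, Metric.infEDist c X

/-- A Delone set: positive packing radius and finite covering radius. -/
def IsDelone (X : Set E) : Prop := 0 < packingRadius X ∧ coveringRadius X < ⊤

/-- The packing-covering ratio `R / r` (a real number for Delone sets in dimension at least 1). -/
def packingCoveringRatio (X : Set E) : ℝ := (coveringRadius X).toReal / (packingRadius X).toReal

/-- An aperiodic set: no nonzero translation maps the set onto itself. -/
def IsAperiodic (X : Set E) : Prop := ∀ t : E, (fun x => x + t) '' X = X → t = 0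

/-- A Meyer set: a Delone set whose set of differences is also a Delone set. -/
def IsMeyer (X : Set E) : Prop :=
  IsDelone X ∧ IsDelone {d : E | ∃ x ∈ X, ∃ y ∈ X, d = x - y}

/-- The `T`-patch of `X` centered at `x`. -/
def patch (X : Set E) (T : ℝ) (x : E) : Set E := X ∩ Metric.ball x T

/-- Translation equivalence of the `T`-patches centered at `x` and at `y`. -/
def PatchEquiv (X : Set E) (T : ℝ) (x y : E) : Prop :=
  patch X T y = (fun z => z + (y - x)) '' patch X T x

/-- The centers in `X` of the `T`-patches that are translation equivalent to the one at `x`. -/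
def patchClass (X : Set E) (T : ℝ) (x : E) : Set E := {y ∈ X | PatchEquiv X T x y}

/-- The patch-counting function `N_X(T)`: the number (possibly infinite) of
translation-inequivalent `T`-patches centered at points of `X`. -/
def patchCount (X : Set E) (T : ℝ) : ℕ∞ := (patchClass X T '' X).encard

/-- The repetitivity function `M_X(T)`: the least `M` (possibly infinite) such that every closed
ball of radius `M` contains the center of a translate of each `T`-patch that occurs in `X`. -/
def repetitivity (X : Set E) (T : ℝ) : ℝ≥0∞ :=
  sInf {M : ℝ≥0∞ | ∀ c : E, ∀ x ∈ X, ∃ y ∈ patchClass X T x, edist y c ≤ M}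

/-- A repetitive set: `M_X(T)` is finite for all `T`. -/
def IsRepetitive (X : Set E) : Prop := ∀ T : ℝ, 0 < T → repetitivity X T < ⊤

/-- Uniform patch frequencies: for every patch that occurs in `X`, the number of its occurrences
with center in the ball `B(c; L)`, divided by the volume of that ball, converges
as `L → ∞`, uniformly in `c`, to a limit that does not depend on `c`. -/
def HasUniformPatchFrequencies [MeasureTheory.MeasureSpace E] (X : Set E) : Prop :=
  ∀ T : ℝ, 0 < T → ∀ x ∈ X, ∃ f : ℝ,
    TendstoUniformly
      (fun (L : ℝ) (c : E) =>
        ((patchClass X T x ∩ Metric.ball c L).ncard : ℝ) /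
          (MeasureTheory.volume (Metric.ball c L)).toReal)
      (fun _ => f) Filter.atTop

end Metric

section Lattice

variable {E : Type*} [NormedAddCommGroup E] [NormedSpace ℝ E]

/-- A (full rank) lattice: a discrete additive subgroup that spans the space over `ℝ`. -/
def IsLattice (L : Submodule ℤ E) : Prop :=
  ∃ _ : DiscreteTopology L, IsZLattice ℝ L

/-- A perturbed lattice `{λ + ⟨φ(λ)⟩ δ : λ ∈ Λ}`, where `Λ` is a lattice, `φ` a linear functional,
`δ` a vector, and `⟨t⟩` is the fractional part of `t`. -/
def IsPerturbedLattice (Z : Set E) : Prop :=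
  ∃ L : Submodule ℤ E, IsLattice L ∧ ∃ (φ : E →ₗ[ℝ] ℝ) (δ : E),
    Z = (fun v => v + Int.fract (φ v) • δ) '' (L : Set E)

/-- A cut-and-project set with physical space `E`, one-dimensional internal space `ℝ` and a
half-open interval `[a, b)` as window: the lattice `L` of `E × ℝ` projects injectively to the
physical space and densely to the internal space. -/
def IsCutAndProject (Z : Set E) : Prop :=
  ∃ L : Submodule ℤ (E × ℝ), IsLattice L ∧ Set.InjOn Prod.fst (L : Set (E × ℝ)) ∧
    Dense (Prod.snd '' (L : Set (E × ℝ))) ∧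
    ∃ a b : ℝ, a < b ∧ Z = Prod.fst '' {l : E × ℝ | l ∈ L ∧ l.2 ∈ Set.Ico a b}

end Lattice

/-- The Delone packing-covering constant `κ(n)`. -/
def kappa (n : ℕ) : ℝ :=
  sInf {k : ℝ | ∃ X : Set (EuclideanSpace ℝ (Fin n)), IsDelone X ∧ k = packingCoveringRatio X}

/-- The lattice packing-covering constant `κ_L(n)`. -/
def kappaL (n : ℕ) : ℝ :=
  sInf {k : ℝ | ∃ L : Submodule ℤ (EuclideanSpace ℝ (Fin n)), IsLattice L ∧
    k = packingCoveringRatio (L : Set (EuclideanSpace ℝ (Fin n)))}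

end

end Delone

/-!
For `T = 2 r_X` every `T`-patch is a single point, so `N_X(T) = 1` and `M_X(T) ≤ R_X`, and both
bounds reduce to `R_X / r_X < κ + 2 ε`. It remains to find aperiodic sets whose ratio `R / r` is
nearly optimal. Small displacements hardly change the ratio: displacing one point of a periodic set
makes it aperiodic, and a lattice `L` is perturbed by the displacements `v ↦ ⟨φ v⟩ δ`, where `φ` is
generic and `δ` is a basis vector of `L` divided by a large integer.

The perturbed lattice is the cut-and-project set of a lattice `Λ` in `E × ℝ`, sheared from `L × ℤ`,
with window `[0, 1)`. Each of its patch classes is again cut out of `Λ` by an interval, and there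
are finitely many of them for each `T`. So repetitivity and uniform patch frequencies both follow
once a cut-and-project set with interval window has a uniform density. To see that it does, take a
window of length `s.2` with `s ∈ Λ`: its translates by `0, s, …, (K - 1) s` stack up to a window of
length `K s.2`, and for large `K` the boundary error in counting lattice points over that window is
relatively small. Since `Λ` projects densely to `ℝ`, any window length is a limit of such `s.2`.
-/

namespace PatchComplexity

open Delone Filter MeasureTheory
open scoped Pointwise Topology

section PackingCovering

variable {E : Type*} [NormedAddCommGroup E] {X : Set E}

theorem ofReal_le_packingRadius {r : ℝ} (h : ∀ x ∈ X, ∀ y ∈ X, x ≠ y → 2 * r ≤ dist x y) :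
    ENNReal.ofReal r ≤ packingRadius X := by
  rw [packingRadius, ENNReal.le_div_iff_mul_le (by simp) (by simp)]
  refine Set.le_einfsep fun x hx y hy hxy => ?_
  rw [edist_dist, mul_comm, ← ENNReal.ofReal_ofNat 2, ← ENNReal.ofReal_mul zero_le_two]
  exact ENNReal.ofReal_le_ofReal (h x hx y hy hxy)

theorem coveringRadius_le_ofReal {R : ℝ} (h : ∀ c, ∃ y ∈ X, dist c y ≤ R) :
    coveringRadius X ≤ ENNReal.ofReal R := by
  refine iSup_le fun c => ?_
  obtain ⟨y, hy, hcy⟩ := h c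
  refine (Metric.infEDist_le_edist_of_mem hy).trans ?_
  rw [edist_dist]
  exact ENNReal.ofReal_le_ofReal hcy

theorem isDelone_of_dist {r R : ℝ} (hr : 0 < r)
    (hpack : ∀ x ∈ X, ∀ y ∈ X, x ≠ y → 2 * r ≤ dist x y) (hcov : ∀ c, ∃ y ∈ X, dist c y ≤ R) :
    IsDelone X :=
  ⟨(ENNReal.ofReal_pos.2 hr).trans_le (ofReal_le_packingRadius hpack),
    (coveringRadius_le_ofReal hcov).trans_lt ENNReal.ofReal_lt_top⟩

theorem two_mul_packingRadius_le_edist {x y : E} (hx : x ∈ X) (hy : y ∈ X) (hxy : x ≠ y) :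
    2 * packingRadius X ≤ edist x y := by
  rw [packingRadius, ENNReal.mul_div_cancel (by simp) (by simp)]
  exact Set.einfsep_le_edist_of_mem hx hy hxy

theorem two_mul_packingRadius_toReal_le_dist {x y : E} (hx : x ∈ X) (hy : y ∈ X) (hxy : x ≠ y) :
    2 * (packingRadius X).toReal ≤ dist x y := by
  have h := ENNReal.toReal_mono (edist_ne_top x y) (two_mul_packingRadius_le_edist hx hy hxy)
  simpa [edist_dist, dist_nonneg] using h

theorem exists_dist_lt_of_isDelone (hX : IsDelone X) {R : ℝ} (hR : (coveringRadius X).toReal < R)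
    (c : E) : ∃ y ∈ X, dist c y < R := by
  have hc : Metric.infEDist c X < ENNReal.ofReal R :=
    (le_iSup (Metric.infEDist · X) c).trans_lt
      ((ENNReal.lt_ofReal_iff_toReal_lt hX.2.ne).2 hR)
  obtain ⟨y, hy, hcy⟩ := Metric.infEDist_lt_iff.1 hc
  exact ⟨y, hy, edist_lt_ofReal.1 hcy⟩

theorem nonempty_of_isDelone (hX : IsDelone X) : X.Nonempty :=
  let ⟨y, hy, _⟩ := exists_dist_lt_of_isDelone hX (lt_add_one _) 0
  ⟨y, hy⟩

theorem packingCoveringRatio_nonneg : 0 ≤ packingCoveringRatio X :=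
  div_nonneg ENNReal.toReal_nonneg ENNReal.toReal_nonneg

variable [NormedSpace ℝ E] [Nontrivial E]

theorem packingRadius_lt_top (hX : IsDelone X) : packingRadius X < ⊤ := by
  obtain ⟨x, hx⟩ := nonempty_of_isDelone hX
  obtain ⟨v, hv⟩ := NormedSpace.exists_lt_norm ℝ E ((coveringRadius X).toReal + 1)
  obtain ⟨y, hy, hxy⟩ := exists_dist_lt_of_isDelone hX (lt_add_one _) (x + v)
  have hne : x ≠ y := by
    rintro rfl
    rw [dist_eq_norm, add_sub_cancel_left] at hxy
    exact hxy.not_gt hv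
  by_contra! htop
  have h := two_mul_packingRadius_le_edist hx hy hne
  rw [top_le_iff.1 htop, ENNReal.mul_top two_ne_zero] at h
  exact edist_ne_top x y (top_le_iff.1 h)

theorem packingRadius_toReal_pos (hX : IsDelone X) : 0 < (packingRadius X).toReal :=
  ENNReal.toReal_pos hX.1.ne' (packingRadius_lt_top hX).ne

theorem packingRadius_le_coveringRadius (hX : IsDelone X) :
    (packingRadius X).toReal ≤ (coveringRadius X).toReal := by
  by_contra! hlt
  obtain ⟨x, hx⟩ := nonempty_of_isDelone hX
  obtain ⟨v, hv⟩ := exists_norm_eq E (packingRadius_toReal_pos hX).le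
  have hd : dist x (x + v) = (packingRadius X).toReal := by
    rw [dist_eq_norm, sub_add_cancel_left, norm_neg, hv]
  obtain ⟨y, hy, hxy⟩ := exists_dist_lt_of_isDelone hX hlt (x + v)
  have hne : x ≠ y := by
    rintro rfl
    rw [dist_comm] at hxy
    exact hxy.ne hd
  linarith [two_mul_packingRadius_toReal_le_dist hx hy hne, dist_triangle x (x + v) y]

theorem coveringRadius_toReal_pos (hX : IsDelone X) : 0 < (coveringRadius X).toReal :=
  (packingRadius_toReal_pos hX).trans_le (packingRadius_le_coveringRadius hX)

theorem packingCoveringRatio_le_of_dist {r R : ℝ} (hr : 0 < r)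
    (hpack : ∀ x ∈ X, ∀ y ∈ X, x ≠ y → 2 * r ≤ dist x y) (hcov : ∀ c, ∃ y ∈ X, dist c y ≤ R) :
    packingCoveringRatio X ≤ R / r := by
  have hX := isDelone_of_dist hr hpack hcov
  have hR : 0 ≤ R := by
    obtain ⟨y, -, hy⟩ := hcov 0
    exact dist_nonneg.trans hy
  exact div_le_div₀ hR
    (ENNReal.toReal_le_of_le_ofReal hR (coveringRadius_le_ofReal hcov)) hr
    ((ENNReal.ofReal_le_iff_le_toReal (packingRadius_lt_top hX).ne).1
      (ofReal_le_packingRadius hpack))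

end PackingCovering

section Perturbation

variable {E : Type*} [NormedAddCommGroup E] {X : Set E}

theorem two_mul_packingRadius_sub_le_dist_image {η : ℝ} {f : E → E}
    (hf : ∀ x ∈ X, dist (f x) x ≤ η) :
    ∀ x ∈ f '' X, ∀ y ∈ f '' X, x ≠ y → 2 * ((packingRadius X).toReal - η) ≤ dist x y := by
  rintro _ ⟨x, hx, rfl⟩ _ ⟨y, hy, rfl⟩ hxy
  have hdist := two_mul_packingRadius_toReal_le_dist hx hy fun h => hxy (by rw [h])
  have htriangle := dist_triangle4 x (f x) (f y) y
  rw [dist_comm x (f x)] at htriangle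
  linarith [hf x hx, hf y hy]

theorem exists_mem_image_dist_le (hX : IsDelone X) {η : ℝ} (hη : 0 < η) {f : E → E}
    (hf : ∀ x ∈ X, dist (f x) x ≤ η) (c : E) :
    ∃ y ∈ f '' X, dist c y ≤ (coveringRadius X).toReal + 2 * η := by
  obtain ⟨y, hy, hcy⟩ := exists_dist_lt_of_isDelone hX (lt_add_of_pos_right _ hη) c
  refine ⟨f y, ⟨y, hy, rfl⟩, ?_⟩
  have htriangle := dist_triangle c y (f y)
  rw [dist_comm y (f y)] at htriangle
  linarith [hf y hy]

variable [NormedSpace ℝ E] [Nontrivial E]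

theorem exists_perturbation (hX : IsDelone X) {k : ℝ} (hk : packingCoveringRatio X < k) :
    ∃ η > 0, ∀ f : E → E, (∀ x ∈ X, dist (f x) x ≤ η) →
      IsDelone (f '' X) ∧ packingCoveringRatio (f '' X) < k := by
  have hk0 : 0 < k := packingCoveringRatio_nonneg.trans_lt hk
  have hr := packingRadius_toReal_pos hX
  rw [packingCoveringRatio, div_lt_iff₀ hr] at hk
  obtain ⟨η, hη, hηr, hηk⟩ : ∃ η > 0, η < (packingRadius X).toReal ∧
      (coveringRadius X).toReal + 2 * η < k * ((packingRadius X).toReal - η) := by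
    have hsmall : ∀ᶠ η in nhdsWithin (0 : ℝ) (Set.Ioi 0),
        (coveringRadius X).toReal + 2 * η < k * ((packingRadius X).toReal - η) :=
      ((by fun_prop : Continuous fun η : ℝ => (coveringRadius X).toReal + 2 * η).continuousAt
        |>.eventually_lt (by fun_prop) (by simpa using hk)).filter_mono nhdsWithin_le_nhds
    obtain ⟨η, hη, hη0, hηr⟩ := (hsmall.and (Ioo_mem_nhdsGT hr)).exists
    exact ⟨η, hη0, hηr, hη⟩
  refine ⟨η, hη, fun f hf => ?_⟩
  have hpack := two_mul_packingRadius_sub_le_dist_image hf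
  have hcov := exists_mem_image_dist_le hX hη hf
  have hr' : 0 < (packingRadius X).toReal - η := sub_pos.2 hηr
  exact ⟨isDelone_of_dist hr' hpack hcov,
    (packingCoveringRatio_le_of_dist hr' hpack hcov).trans_lt ((div_lt_iff₀ hr').2 hηk)⟩

end Perturbation

section Aperiodic

theorem add_mem_iff_of_image_add_eq {G : Type*} [AddGroup G] {X : Set G} {t : G}
    (h : (fun x => x + t) '' X = X) {y : G} : y + t ∈ X ↔ y ∈ X := by
  conv_lhs => rw [← h]
  exact (add_left_injective t).mem_set_image

variable {E : Type*} [NormedAddCommGroup E] [NormedSpace ℝ E] {X : Set E}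

theorem isAperiodic_insert_sdiff_singleton (hX : ¬ IsAperiodic X) {x x' : E} (hx' : x' ∉ X) :
    IsAperiodic (insert x' (X \ {x})) := by
  simp only [IsAperiodic, not_forall] at hX
  obtain ⟨t, hXt, ht⟩ := hX
  have htX {y : E} : y + t ∈ X ↔ y ∈ X := add_mem_iff_of_image_add_eq hXt
  intro s hs
  by_contra hs0
  set Y := insert x' (X \ {x})
  have hsY {y : E} : y + s ∈ Y ↔ y ∈ Y := add_mem_iff_of_image_add_eq hs
  -- At most one of `x' + s + t` and `x' + 2 s + t` is the removed point.
  obtain ⟨u, hu0, huY, hux⟩ : ∃ u, u ≠ 0 ∧ (∀ y, y + u ∈ Y ↔ y ∈ Y) ∧ x' + u + t ≠ x := by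
    by_cases hsx : x' + s + t = x
    · refine ⟨s + s, ?_, fun y => by rw [← add_assoc, hsY, hsY], fun h => hs0 ?_⟩
      · rw [← two_smul ℝ]
        exact smul_ne_zero two_ne_zero hs0
      · rw [← hsx] at h
        simpa using h
    · exact ⟨s, hs0, fun y => hsY, hsx⟩
  have huX : x' + u ∈ X :=
    (Set.mem_of_mem_insert_of_ne ((huY x').2 (Set.mem_insert _ _)) (by simpa using hu0)).1
  have htY : x' + t ∈ Y := (huY _).1 (.inr ⟨by rwa [add_right_comm, htX],
    by rwa [add_right_comm]⟩)
  exact hx' (htX.1 (Set.mem_of_mem_insert_of_ne htY (by simpa using ht)).1)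

variable [Nontrivial E]

theorem exists_isAperiodic (hX : IsDelone X) {k : ℝ} (hk : packingCoveringRatio X < k) :
    ∃ Y : Set E, IsDelone Y ∧ packingCoveringRatio Y < k ∧ IsAperiodic Y := by
  classical
  by_cases hap : IsAperiodic X
  · exact ⟨X, hX, hk, hap⟩
  obtain ⟨η, hη, hperturb⟩ := exists_perturbation hX hk
  obtain ⟨x, hx⟩ := nonempty_of_isDelone hX
  have hr := packingRadius_toReal_pos hX
  obtain ⟨v, hv⟩ := exists_norm_eq E (le_min hη.le hr.le)
  have hv0 : v ≠ 0 := norm_pos_iff.1 (hv ▸ lt_min hη hr)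
  have hvX : x + v ∉ X := by
    intro hmem
    have hdist := two_mul_packingRadius_toReal_le_dist hmem hx (by simpa using hv0)
    rw [dist_eq_norm, add_sub_cancel_left, hv] at hdist
    linarith [min_le_right η (packingRadius X).toReal]
  let f : E → E := fun y => if y = x then x + v else y
  have himage : f '' X = insert (x + v) (X \ {x}) := by
    ext y
    simp only [f, Set.mem_image, Set.mem_insert_iff, Set.mem_sdiff, Set.mem_singleton_iff]
    grind
  obtain ⟨hY, hYk⟩ := hperturb f fun y _ => by
    by_cases hyx : y = x
    · simp [f, hyx, hv]
    · simp [f, hyx, hη.le]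
  rw [himage] at hY hYk
  exact ⟨_, hY, hYk, isAperiodic_insert_sdiff_singleton hap hvX⟩

end Aperiodic

section SmallPatches

variable {E : Type*} [NormedAddCommGroup E] {X : Set E}

theorem patchClass_eq_of_forall_le_dist {T : ℝ} (hT : 0 < T)
    (hpack : ∀ x ∈ X, ∀ y ∈ X, x ≠ y → T ≤ dist x y) {x : E} (hx : x ∈ X) :
    patchClass X T x = X := by
  have hpatch : ∀ y ∈ X, patch X T y = {y} := by
    refine fun y hy => Set.Subset.antisymm (fun z ⟨hz, hzy⟩ => ?_) ?_
    · by_contra hne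
      exact (hpack z hz y hy hne).not_gt hzy
    · exact Set.singleton_subset_iff.2 ⟨hy, Metric.mem_ball_self hT⟩
  refine Set.Subset.antisymm (Set.sep_subset _ _) fun y hy => ⟨hy, ?_⟩
  rw [PatchEquiv, hpatch x hx, hpatch y hy, Set.image_singleton, add_sub_cancel]

theorem patchCount_eq_one (hX : X.Nonempty) {T : ℝ} (h : ∀ x ∈ X, patchClass X T x = X) :
    patchCount X T = 1 := by
  rw [patchCount, Set.image_congr h, hX.image_const, Set.encard_singleton]

theorem repetitivity_le_ofReal {T M : ℝ}
    (h : ∀ c, ∀ x ∈ X, ∃ y ∈ patchClass X T x, dist y c ≤ M) :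
    repetitivity X T ≤ ENNReal.ofReal M := by
  refine sInf_le fun c x hx => (h c x hx).imp fun y hy => ⟨hy.1, ?_⟩
  rw [edist_dist]
  exact ENNReal.ofReal_le_ofReal hy.2

theorem exists_patchCount_lt_and_repetitivity_lt [NormedSpace ℝ E] [Nontrivial E]
    (hX : IsDelone X) {k : ℝ} (hk : packingCoveringRatio X < 2 * k) :
    ∃ T : ℝ, 0 < T ∧
      (patchCount X T : ℝ≥0∞) < ENNReal.ofReal (k * (T / (coveringRadius X).toReal)) ∧
      repetitivity X T < ENNReal.ofReal (k * T) := by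
  have hr := packingRadius_toReal_pos hX
  have hR := coveringRadius_toReal_pos hX
  set T := 2 * (packingRadius X).toReal
  have hT : 0 < T := by positivity
  have hRT : (coveringRadius X).toReal < k * T := by
    rw [packingCoveringRatio, div_lt_iff₀ hr] at hk
    linarith
  have hclass : ∀ x ∈ X, patchClass X T x = X := fun x hx =>
    patchClass_eq_of_forall_le_dist hT
      (fun _ hx _ hy => two_mul_packingRadius_toReal_le_dist hx hy) hx
  refine ⟨T, hT, ?_, ?_⟩
  · rw [patchCount_eq_one (nonempty_of_isDelone hX) hclass, ENat.toENNReal_one,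
      ENNReal.one_lt_ofReal, ← mul_div_assoc, one_lt_div hR]
    exact hRT
  · obtain ⟨M, hRM, hMT⟩ := exists_between hRT
    refine (repetitivity_le_ofReal fun c x hx => ?_).trans_lt
      ((ENNReal.ofReal_lt_ofReal_iff_of_nonneg (hR.le.trans hRM.le)).2 hMT)
    obtain ⟨y, hy, hcy⟩ := exists_dist_lt_of_isDelone hX hRM c
    exact ⟨y, (hclass x hx).symm ▸ hy, dist_comm c y ▸ hcy.le⟩

end SmallPatches

section Differences

variable {E : Type*} [NormedAddCommGroup E] {X : Set E}

theorem exists_pos_le_norm_of_finite {K : Set E} (hK : K.Finite) (h0 : 0 ∉ K) :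
    ∃ ρ > 0, ∀ v ∈ K, ρ ≤ ‖v‖ := by
  rcases K.eq_empty_or_nonempty with rfl | hne
  · exact ⟨1, one_pos, by simp⟩
  · obtain ⟨v, hv, hmin⟩ := K.exists_min_image (‖·‖) hK hne
    exact ⟨‖v‖, norm_pos_iff.2 fun h => h0 (h ▸ hv), hmin⟩

theorem isDelone_of_finite_sub_inter_ball (hfin : ((X - X) ∩ Metric.ball 0 1).Finite) {R : ℝ}
    (hcov : ∀ c, ∃ y ∈ X, dist c y ≤ R) : IsDelone X := by
  obtain ⟨ρ, hρ, hmin⟩ := exists_pos_le_norm_of_finite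
    (hfin.subset (Set.sdiff_subset (t := {0}))) (fun h => h.2 rfl)
  refine isDelone_of_dist (r := min ρ 1 / 2) (by positivity) (fun x hx y hy hxy => ?_) hcov
  rw [mul_div_cancel₀ _ two_ne_zero, dist_eq_norm, min_le_iff]
  by_cases h1 : ‖x - y‖ < 1
  · exact .inl (hmin _ ⟨⟨Set.sub_mem_sub hx hy, mem_ball_zero_iff.2 h1⟩, sub_ne_zero.2 hxy⟩)
  · exact .inr (not_lt.1 h1)

theorem isMeyer_iff : IsMeyer X ↔ IsDelone X ∧ IsDelone (X - X) := by
  have hsub : {d : E | ∃ x ∈ X, ∃ y ∈ X, d = x - y} = X - X := by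
    ext d
    simp only [Set.mem_ofPred_eq, Set.mem_sub, eq_comm]
  rw [IsMeyer, hsub]

theorem exists_mem_sub_dist_le (hne : X.Nonempty) {R : ℝ} (hcov : ∀ c, ∃ y ∈ X, dist c y ≤ R)
    (c : E) : ∃ d ∈ X - X, dist c d ≤ R := by
  obtain ⟨x, hx⟩ := hne
  obtain ⟨y, hy, hcy⟩ := hcov (c + x)
  exact ⟨y - x, Set.sub_mem_sub hy hx, by rwa [dist_sub_eq_dist_add_right]⟩

theorem finite_inter_of_isBounded [ProperSpace E] (L : Submodule ℤ E) [DiscreteTopology L]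
    {B : Set E} (hB : Bornology.IsBounded B) : (B ∩ L).Finite :=
  have : DiscreteTopology L.toAddSubgroup := ‹DiscreteTopology L›
  Metric.finite_isBounded_inter_isClosed ⟨‹_›⟩ hB
    (AddSubgroup.isClosed_of_discrete (H := L.toAddSubgroup))

end Differences

section Lattice

variable {V : Type*} [NormedAddCommGroup V] [NormedSpace ℝ V] [FiniteDimensional ℝ V]
  (L : Submodule ℤ V) [DiscreteTopology L] [IsZLattice ℝ L]

theorem exists_basis : ∃ b : Module.Basis (Fin (Module.finrank ℝ V)) ℝ V,
    Submodule.span ℤ (Set.range b) = L := by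
  have : Module.Finite ℤ L := ZLattice.module_finite ℝ L
  have : Module.Free ℤ L := ZLattice.module_free ℝ L
  exact ⟨(Module.finBasisOfFinrankEq ℤ L (ZLattice.rank ℝ L)).ofZLatticeBasis ℝ L,
    Module.Basis.ofZLatticeBasis_span ..⟩

theorem isDelone_coe : IsDelone (L : Set V) := by
  have := FiniteDimensional.proper_real V
  have hfin : (((L : Set V) - L) ∩ Metric.ball 0 1).Finite := by
    rw [coe_sub_coe, Set.inter_comm]
    exact finite_inter_of_isBounded L Metric.isBounded_ball
  obtain ⟨b, rfl⟩ := exists_basis L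
  exact isDelone_of_finite_sub_inter_ball hfin fun c => ⟨ZSpan.floor b c, (ZSpan.floor b c).2,
    (dist_eq_norm c _).trans_le (ZSpan.norm_fract_le b c)⟩

end Lattice

section ModelSet

variable {E F : Type*} [NormedAddCommGroup E] [NormedAddCommGroup F]

/-- The model set (cut-and-project set) with window `W`: the projections to the physical space `E`
of the points of `Λ` whose heights in the internal space `F` lie in `W`. -/
def modelSet (Λ : Submodule ℤ (E × F)) (W : Set F) : Set E :=
  Prod.fst '' {l : E × F | l ∈ Λ ∧ l.2 ∈ W}

variable {Λ : Submodule ℤ (E × F)} {W W' : Set F}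

theorem fst_mem_modelSet_iff (hinj : Set.InjOn Prod.fst (Λ : Set (E × F))) {l : E × F}
    (hl : l ∈ Λ) : l.1 ∈ modelSet Λ W ↔ l.2 ∈ W := by
  refine ⟨?_, fun h => ⟨l, ⟨hl, h⟩, rfl⟩⟩
  rintro ⟨k, ⟨hk, hkW⟩, hkl⟩
  rwa [← hinj hk hl hkl]

theorem modelSet_mono (h : W ⊆ W') : modelSet Λ W ⊆ modelSet Λ W' :=
  Set.image_mono fun _ hl => ⟨hl.1, h hl.2⟩

theorem modelSet_sub_subset : modelSet Λ W - modelSet Λ W' ⊆ modelSet Λ (W - W') := by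
  rintro _ ⟨_, ⟨l, ⟨hl, hlW⟩, rfl⟩, _, ⟨k, ⟨hk, hkW⟩, rfl⟩, rfl⟩
  exact ⟨l - k, ⟨sub_mem hl hk, Set.sub_mem_sub hlW hkW⟩, rfl⟩

theorem finite_modelSet_inter_ball [ProperSpace E] [ProperSpace F] [DiscreteTopology Λ]
    (hW : Bornology.IsBounded W) (c : E) (ρ : ℝ) : (modelSet Λ W ∩ Metric.ball c ρ).Finite := by
  refine ((finite_inter_of_isBounded Λ
    ((Metric.isBounded_ball (x := c) (r := ρ)).prod hW)).image Prod.fst).subset ?_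
  rintro _ ⟨⟨l, ⟨hl, hlW⟩, rfl⟩, hlc⟩
  exact ⟨l, ⟨⟨hlc, hlW⟩, hl⟩, rfl⟩

theorem isMeyer_modelSet [ProperSpace E] [ProperSpace F] [DiscreteTopology Λ]
    (hW : Bornology.IsBounded W) {R : ℝ} (hcov : ∀ c, ∃ y ∈ modelSet Λ W, dist c y ≤ R) :
    IsMeyer (modelSet Λ W) := by
  have hsub : modelSet Λ W - modelSet Λ W ⊆ modelSet Λ (W - W) := modelSet_sub_subset
  refine isMeyer_iff.2 ⟨?_, ?_⟩
  · refine isDelone_of_finite_sub_inter_ball ?_ hcov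
    exact (finite_modelSet_inter_ball (hW.sub hW) 0 1).subset (Set.inter_subset_inter_left _ hsub)
  · obtain ⟨y, hy, -⟩ := hcov 0
    refine isDelone_of_finite_sub_inter_ball ?_ (exists_mem_sub_dist_le ⟨y, hy⟩ hcov)
    exact (finite_modelSet_inter_ball ((hW.sub hW).sub (hW.sub hW)) 0 1).subset
      (Set.inter_subset_inter_left _ ((Set.sub_subset_sub hsub hsub).trans modelSet_sub_subset))

theorem isAperiodic_modelSet [NormedSpace ℝ F] (hfst : Set.InjOn Prod.fst (Λ : Set (E × F)))
    (hsnd : Set.InjOn Prod.snd (Λ : Set (E × F))) (hW : Bornology.IsBounded W)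
    (hne : (modelSet Λ W).Nonempty) : IsAperiodic (modelSet Λ W) := by
  intro t ht
  have hperiod {x : E} : x + t ∈ modelSet Λ W ↔ x ∈ modelSet Λ W := add_mem_iff_of_image_add_eq ht
  obtain ⟨_, l, ⟨hl, hlW⟩, rfl⟩ := hne
  obtain ⟨d, hd, rfl⟩ : ∃ d ∈ Λ, d.1 = t := by
    obtain ⟨k, ⟨hk, -⟩, hkt⟩ := hperiod.2 ((fst_mem_modelSet_iff hfst hl).2 hlW)
    exact ⟨k - l, sub_mem hk hl, sub_eq_iff_eq_add'.2 hkt⟩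
  have hheights (k : ℕ) : l.2 + k • d.2 ∈ W := by
    refine (fst_mem_modelSet_iff hfst (add_mem hl (nsmul_mem hd k))).1 ?_
    induction k with
    | zero => simpa using (fst_mem_modelSet_iff hfst hl).2 hlW
    | succ k ih => simpa [succ_nsmul, ← add_assoc] using hperiod.2 ih
  obtain ⟨C, hC⟩ := hW.exists_norm_le
  suffices d.2 = 0 by
    rw [hsnd hd (zero_mem Λ) this, Prod.fst_zero]
  by_contra hd0
  obtain ⟨k, hk⟩ := exists_nat_gt ((C + ‖l.2‖) / ‖d.2‖)
  rw [div_lt_iff₀ (norm_pos_iff.2 hd0)] at hk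
  have hnorm : ‖k • d.2‖ = k * ‖d.2‖ := by
    rw [← Nat.cast_smul_eq_nsmul ℝ, norm_smul, Real.norm_natCast]
  have hle := norm_sub_le (l.2 + k • d.2) l.2
  rw [add_sub_cancel_left, hnorm] at hle
  linarith [hC _ (hheights k)]

end ModelSet

section Patches

variable {E F : Type*} [NormedAddCommGroup E] [NormedAddCommGroup F]

theorem patchEquiv_iff {X : Set E} {T : ℝ} {x y : E} :
    PatchEquiv X T x y ↔ ∀ v, ‖v‖ < T → (x + v ∈ X ↔ y + v ∈ X) := by
  have hmem (v : E) : y + v ∈ (fun z => z + (y - x)) '' patch X T x ↔ x + v ∈ patch X T x := by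
    rw [show y + v = x + v + (y - x) by abel]
    exact (add_left_injective (y - x)).mem_set_image
  have hpatch (z v : E) : z + v ∈ patch X T z ↔ z + v ∈ X ∧ ‖v‖ < T := by
    simp [patch]
  rw [PatchEquiv, Set.ext_iff, (Equiv.addLeft y).surjective.forall]
  simp only [Equiv.coe_addLeft, hmem, hpatch, and_congr_left_iff, iff_comm]

variable {Λ : Submodule ℤ (E × F)} {W : Set F} {T : ℝ}

/-- The heights of the vectors of `Λ` of physical length less than `T` that can join two points of
the model set with window `W`: they decide which `T`-patch occurs at a point. -/
def patchHeights (Λ : Submodule ℤ (E × F)) (W : Set F) (T : ℝ) : Set F :=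
  Prod.snd '' {h : E × F | h ∈ Λ ∧ ‖h.1‖ < T ∧ h.2 ∈ W - W}

/-- The part of the window `W` in which the points of height `s` meet the same translates of `W`
by the elements of `-H` as the point `s₀`. -/
def subwindow (W H : Set F) (s₀ : F) : Set F :=
  {s ∈ W | ∀ h ∈ H, s₀ + h ∈ W ↔ s + h ∈ W}

theorem patchEquiv_modelSet_iff (hinj : Set.InjOn Prod.fst (Λ : Set (E × F))) {l k : E × F}
    (hl : l ∈ Λ) (hlW : l.2 ∈ W) (hk : k ∈ Λ) (hkW : k.2 ∈ W) :
    PatchEquiv (modelSet Λ W) T l.1 k.1 ↔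
      ∀ h ∈ patchHeights Λ W T, l.2 + h ∈ W ↔ k.2 + h ∈ W := by
  have hadd {l h : E × F} (hl : l ∈ Λ) (hh : h ∈ Λ) : l.1 + h.1 ∈ modelSet Λ W ↔ l.2 + h.2 ∈ W :=
    fst_mem_modelSet_iff hinj (add_mem hl hh)
  rw [patchEquiv_iff]
  constructor
  · rintro hv _ ⟨h, ⟨hh, hhT, -⟩, rfl⟩
    rw [← hadd hl hh, ← hadd hk hh, hv _ hhT]
  · have himp {l k : E × F} (hl : l ∈ Λ) (hlW : l.2 ∈ W) (hk : k ∈ Λ) {v : E} (hv : ‖v‖ < T)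
        (hlk : ∀ h ∈ patchHeights Λ W T, l.2 + h ∈ W ↔ k.2 + h ∈ W)
        (hlv : l.1 + v ∈ modelSet Λ W) : k.1 + v ∈ modelSet Λ W := by
      obtain ⟨m, ⟨hm, hmW⟩, hmv⟩ := hlv
      obtain rfl : (m - l).1 = v := sub_eq_iff_eq_add'.2 hmv
      rw [hadd hk (sub_mem hm hl),
        ← hlk _ ⟨m - l, ⟨sub_mem hm hl, hv, Set.sub_mem_sub hmW hlW⟩, rfl⟩]
      simpa using hmW
    exact fun hlk v hv => ⟨himp hl hlW hk hv hlk, himp hk hkW hl hv fun h hh => (hlk h hh).symm⟩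

theorem patchClass_modelSet (hinj : Set.InjOn Prod.fst (Λ : Set (E × F))) {l : E × F}
    (hl : l ∈ Λ) (hlW : l.2 ∈ W) :
    patchClass (modelSet Λ W) T l.1 = modelSet Λ (subwindow W (patchHeights Λ W T) l.2) := by
  ext z
  constructor
  · rintro ⟨⟨k, ⟨hk, hkW⟩, rfl⟩, hlk⟩
    exact ⟨k, ⟨hk, hkW, (patchEquiv_modelSet_iff hinj hl hlW hk hkW).1 hlk⟩, rfl⟩
  · rintro ⟨k, ⟨hk, hkW, hlk⟩, rfl⟩
    exact ⟨⟨k, ⟨hk, hkW⟩, rfl⟩, (patchEquiv_modelSet_iff hinj hl hlW hk hkW).2 hlk⟩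

theorem finite_patchHeights [ProperSpace E] [ProperSpace F] [DiscreteTopology Λ]
    (hW : Bornology.IsBounded W) : (patchHeights Λ W T).Finite := by
  refine ((finite_inter_of_isBounded Λ
    ((Metric.isBounded_ball (x := (0 : E)) (r := T)).prod (hW.sub hW))).image Prod.snd).subset ?_
  rintro _ ⟨h, ⟨hh, hhT, hhW⟩, rfl⟩
  exact ⟨h, ⟨⟨mem_ball_zero_iff.2 hhT, hhW⟩, hh⟩, rfl⟩

theorem finite_range_subwindow {H : Set F} (hH : H.Finite) :
    (Set.range (subwindow W H)).Finite := by
  refine (hH.powerset.image fun A => {s ∈ W | ∀ h ∈ H, h ∈ A ↔ s + h ∈ W}).subset ?_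
  rintro _ ⟨s₀, rfl⟩
  refine ⟨{h ∈ H | s₀ + h ∈ W}, Set.sep_subset _ _, ?_⟩
  ext s
  simp +contextual [subwindow]

theorem finite_patchClass_image_modelSet [ProperSpace E] [ProperSpace F] [DiscreteTopology Λ]
    (hinj : Set.InjOn Prod.fst (Λ : Set (E × F))) (hW : Bornology.IsBounded W) :
    (patchClass (modelSet Λ W) T '' modelSet Λ W).Finite := by
  have hwindows := finite_range_subwindow (W := W) (finite_patchHeights (Λ := Λ) (T := T) hW)
  refine (hwindows.image (modelSet Λ)).subset ?_
  rintro _ ⟨_, ⟨l, ⟨hl, hlW⟩, rfl⟩, rfl⟩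
  exact ⟨_, ⟨l.2, rfl⟩, (patchClass_modelSet hinj hl hlW).symm⟩

theorem exists_Ico_inter_eq_sep {a b s₀ : ℝ} (hs₀ : s₀ ∈ Set.Ico a b) (h : ℝ) :
    ∃ α β, s₀ ∈ Set.Ico α β ∧
      {s ∈ Set.Ico a b | s₀ + h ∈ Set.Ico a b ↔ s + h ∈ Set.Ico a b} =
        Set.Ico a b ∩ Set.Ico α β := by
  obtain ⟨ha, hb⟩ := hs₀
  rcases lt_or_ge (s₀ + h) a with hlow | hlow
  · refine ⟨a, a - h, ⟨ha, by linarith⟩, ?_⟩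
    ext s
    grind
  rcases lt_or_ge (s₀ + h) b with hhigh | hhigh
  · refine ⟨a - h, b - h, ⟨by linarith, by linarith⟩, ?_⟩
    ext s
    grind
  · refine ⟨b - h, b, ⟨by linarith, hb⟩, ?_⟩
    ext s
    grind

theorem exists_subwindow_Ico_eq {a b s₀ : ℝ} (hs₀ : s₀ ∈ Set.Ico a b) {H : Set ℝ}
    (hH : H.Finite) : ∃ α β, α < β ∧ subwindow (Set.Ico a b) H s₀ = Set.Ico α β := by
  suffices ∃ α β, s₀ ∈ Set.Ico α β ∧ subwindow (Set.Ico a b) H s₀ = Set.Ico α β by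
    obtain ⟨α, β, hs, h⟩ := this
    exact ⟨α, β, hs.1.trans_lt hs.2, h⟩
  induction H, hH using Set.Finite.induction_on with
  | empty =>
    refine ⟨a, b, hs₀, ?_⟩
    simp only [subwindow, Set.forall_mem_empty, and_true, Set.ofPred_mem_eq]
  | @insert h H _ _ ih =>
    obtain ⟨α, β, hs, ih⟩ := ih
    obtain ⟨α', β', hs', hh⟩ := exists_Ico_inter_eq_sep hs₀ h
    refine ⟨max α α', min β β', ⟨max_le hs.1 hs'.1, lt_min hs.2 hs'.2⟩, ?_⟩
    rw [← Set.Ico_inter_Ico, ← ih]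
    ext s
    have hiff := Set.ext_iff.1 hh s
    simp only [subwindow, Set.mem_ofPred_eq, Set.mem_inter_iff, Set.forall_mem_insert] at hiff ⊢
    tauto

end Patches

section Density

variable {E : Type*} [NormedAddCommGroup E]

/-- The number of points of `X` in the open ball `B(c; ρ)`, or `0` if there are infinitely many. -/
noncomputable def ballCount (X : Set E) (c : E) (ρ : ℝ) : ℕ := (X ∩ Metric.ball c ρ).ncard

variable [MeasurableSpace E]

/-- The number of points of `X` in a ball divided by the volume of the ball tends to `f`, uniformly
in the center, as the radius tends to infinity. -/
def HasUniformDensity (μ : Measure E) (X : Set E) (f : ℝ) : Prop :=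
  TendstoUniformly (fun (ρ : ℝ) (c : E) => (ballCount X c ρ : ℝ) / μ.real (Metric.ball c ρ))
    (fun _ => f) atTop

theorem HasUniformDensity.exists_mem_dist_le {μ : Measure E} {X : Set E} {f : ℝ}
    (h : HasUniformDensity μ X f) (hf : 0 < f) : ∃ R : ℝ, ∀ c, ∃ y ∈ X, dist c y ≤ R := by
  obtain ⟨R, hR⟩ := (Metric.tendstoUniformly_iff.1 h f hf).exists
  refine ⟨R, fun c => ?_⟩
  obtain ⟨y, hy, hyc⟩ : (X ∩ Metric.ball c R).Nonempty := by
    by_contra! hempty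
    simpa [ballCount, hempty, abs_of_pos hf] using hR c
  exact ⟨y, hy, (Metric.mem_ball'.1 hyc).le⟩

variable [NormedSpace ℝ E] [FiniteDimensional ℝ E] (μ : Measure E) [μ.IsAddHaarMeasure]

theorem measureReal_ball_pos {ρ : ℝ} (hρ : 0 < ρ) : 0 < μ.real (Metric.ball (0 : E) ρ) :=
  ENNReal.toReal_pos (Metric.measure_ball_pos μ 0 hρ).ne' measure_ball_lt_top.ne

variable [BorelSpace E]

theorem tendsto_measureReal_ball_add_div (d : ℝ) :
    Tendsto (fun ρ => μ.real (Metric.ball (0 : E) (ρ + d)) / μ.real (Metric.ball (0 : E) ρ))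
      atTop (𝓝 1) := by
  have hball (ρ : ℝ) (hρ : 0 < ρ) : μ.real (Metric.ball (0 : E) ρ) =
      ρ ^ Module.finrank ℝ E * μ.real (Metric.ball (0 : E) 1) := by
    rw [measureReal_def, Measure.addHaar_ball_of_pos μ 0 hρ, ENNReal.toReal_mul,
      ENNReal.toReal_ofReal (by positivity), measureReal_def]
  have hone : μ.real (Metric.ball (0 : E) 1) ≠ 0 :=
    (measureReal_ball_pos μ one_pos).ne'
  have hlim : Tendsto (fun ρ : ℝ => (1 + d / ρ) ^ Module.finrank ℝ E) atTop (𝓝 1) := by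
    simpa using ((tendsto_const_nhds (x := d)).div_atTop tendsto_id).const_add 1 |>.pow
      (Module.finrank ℝ E)
  refine hlim.congr' ?_
  filter_upwards [eventually_gt_atTop 0, eventually_gt_atTop (-d)] with ρ hρ hρd
  rw [hball ρ hρ, hball (ρ + d) (by linarith), mul_div_mul_right _ _ hone, ← div_pow, add_div,
    div_self hρ.ne']

variable {μ}

theorem hasUniformDensity_of_le {X : Set E} {f : ℝ}
    (hlow : ∀ ε > 0, ∃ d, ∀ c ρ,
      (f - ε) * μ.real (Metric.ball (0 : E) (ρ + d)) ≤ ballCount X c ρ)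
    (hhigh : ∀ ε > 0, ∃ d, ∀ c ρ,
      ballCount X c ρ ≤ (f + ε) * μ.real (Metric.ball (0 : E) (ρ + d))) :
    HasUniformDensity μ X f := by
  rw [HasUniformDensity, Metric.tendstoUniformly_iff]
  intro ε hε
  obtain ⟨d, hd⟩ := hlow (ε / 2) (half_pos hε)
  obtain ⟨d', hd'⟩ := hhigh (ε / 2) (half_pos hε)
  have hlow := ((tendsto_measureReal_ball_add_div μ d).const_mul (f - ε / 2)).eventually_const_lt
    (show f - ε < (f - ε / 2) * 1 by linarith)
  have hhigh := ((tendsto_measureReal_ball_add_div μ d').const_mul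
    (f + ε / 2)).eventually_lt_const (show (f + ε / 2) * 1 < f + ε by linarith)
  filter_upwards [hlow, hhigh, eventually_gt_atTop 0] with ρ hlow hhigh hρ c
  have hvol : 0 < μ.real (Metric.ball (0 : E) ρ) := measureReal_ball_pos μ hρ
  rw [← mul_div_assoc] at hlow hhigh
  rw [dist_comm, Real.dist_eq, abs_sub_lt_iff, Measure.addHaar_real_ball_center μ c]
  constructor
  · linarith [div_le_div_of_nonneg_right (hd' c ρ) hvol.le]
  · linarith [div_le_div_of_nonneg_right (hd c ρ) hvol.le]

end Density

section LatticeCounting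

variable {V : Type*} [NormedAddCommGroup V] [NormedSpace ℝ V] [FiniteDimensional ℝ V]
  [MeasurableSpace V] [BorelSpace V] (L : Submodule ℤ V) [DiscreteTopology L] [IsZLattice ℝ L]
  (ν : Measure V) [ν.IsAddHaarMeasure]

theorem exists_tiling : ∃ D > 0, ∃ tile : V → Set V, (∀ v, tile v ⊆ Metric.closedBall v D) ∧
    (∀ x, ∃ v ∈ L, x ∈ tile v) ∧ ∀ A : Finset V, (A : Set V) ⊆ L →
      ν.real (⋃ v ∈ A, tile v) = A.card * ZLattice.covolume L ν := by
  obtain ⟨b, rfl⟩ := exists_basis L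
  set S := ZSpan.fundamentalDomain b
  have hS : MeasurableSet S := ZSpan.fundamentalDomain_measurableSet b
  obtain ⟨D, hD0, hD⟩ := (ZSpan.fundamentalDomain_isBounded b).subset_closedBall_lt 0 0
  refine ⟨D, hD0, fun v => v +ᵥ S, fun v => ?_, fun x => ?_, fun A hA => ?_⟩
  · simpa using Set.vadd_set_mono (a := v) hD
  · exact ⟨ZSpan.floor b x, (ZSpan.floor b x).2, ZSpan.fract b x,
      ZSpan.fract_mem_fundamentalDomain b x, by simp [ZSpan.fract]⟩
  · have hdisj : (A : Set V).PairwiseDisjoint fun v => v +ᵥ S := by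
      intro v hv w hw hvw
      refine Set.disjoint_left.2 fun x hxv hxw => hvw ?_
      have hmem {u : V} (hu : u ∈ A) (hxu : x ∈ u +ᵥ S) :
          (-⟨u, hA hu⟩ : Submodule.span ℤ (Set.range b)) +ᵥ x ∈ S :=
        Set.mem_vadd_set_iff_neg_vadd_mem.1 hxu
      have huniq := (ZSpan.exist_unique_vadd_mem_fundamentalDomain b x).unique
        (hmem hv hxv) (hmem hw hxw)
      simpa using huniq
    rw [measureReal_biUnion_finset hdisj (fun v _ => hS.const_vadd v)
      (fun v _ => by
        rw [measure_vadd]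
        exact (ZSpan.fundamentalDomain_isBounded b).measure_lt_top.ne),
      ZLattice.covolume_eq_measure_fundamentalDomain _ ν (ZSpan.isAddFundamentalDomain b ν)]
    simp [measureReal_def, measure_vadd, S]

theorem exists_card_mul_covolume_bounds : ∃ D > 0, ∀ (A : Finset V) (U : Set V), (A : Set V) ⊆ L →
    ν U ≠ ⊤ → ((∀ v ∈ A, Metric.closedBall v D ⊆ U) →
        A.card * ZLattice.covolume L ν ≤ ν.real U) ∧
      ((∀ v ∈ L, (Metric.closedBall v D ∩ U).Nonempty → v ∈ A) →
        ν.real U ≤ A.card * ZLattice.covolume L ν) := by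
  obtain ⟨D, hD, tile, htile, hcover, hvol⟩ := exists_tiling L ν
  refine ⟨D, hD, fun A U hA hU => ⟨fun h => ?_, fun h => ?_⟩⟩
  · rw [← hvol A hA]
    exact measureReal_mono (Set.iUnion₂_subset fun v hv => (htile v).trans (h v hv)) hU
  · rw [← hvol A hA]
    refine measureReal_mono (fun x hx => ?_) ?_
    · obtain ⟨v, hv, hxv⟩ := hcover x
      exact Set.mem_iUnion₂_of_mem (h v hv ⟨x, htile v hxv, hx⟩) hxv
    · refine (measure_biUnion_lt_top A.finite_toSet fun v _ => ?_).ne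
      exact (measure_mono (htile v)).trans_lt measure_closedBall_lt_top

end LatticeCounting

section Equidistribution

variable {E : Type*} [NormedAddCommGroup E]

theorem ballCount_le_ballCount {X : Set E} {c c' : E} {ρ ρ' : ℝ}
    (hfin : (X ∩ Metric.ball c' ρ').Finite) (h : ρ + dist c c' ≤ ρ') :
    ballCount X c ρ ≤ ballCount X c' ρ' :=
  Set.ncard_le_ncard (Set.inter_subset_inter_right _ (Metric.ball_subset_ball' h)) hfin

theorem ballCount_image_add_right (X : Set E) (t c : E) (ρ : ℝ) :
    ballCount ((fun x => x + t) '' X) c ρ = ballCount X (c - t) ρ := by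
  have hset : (fun x => x + t) '' X ∩ Metric.ball c ρ =
      (fun x => x + t) '' (X ∩ Metric.ball (c - t) ρ) := by
    rw [← Metric.preimage_add_right_ball, Set.image_inter_preimage]
  rw [ballCount, hset, Set.ncard_image_of_injective _ (add_left_injective t), ballCount]

section Windows

variable {F : Type*} [NormedAddCommGroup F] {Λ : Submodule ℤ (E × F)}

theorem modelSet_image_add_right {s : E × F} (hs : s ∈ Λ) (W : Set F) :
    modelSet Λ ((fun h => h + s.2) '' W) = (fun x => x + s.1) '' modelSet Λ W := by
  ext x
  constructor
  · rintro ⟨l, ⟨hl, h, hh, hhl⟩, rfl⟩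
    exact ⟨_, ⟨l - s, ⟨sub_mem hl hs, by rwa [Prod.snd_sub, ← hhl, add_sub_cancel_right]⟩, rfl⟩,
      sub_add_cancel _ _⟩
  · rintro ⟨_, ⟨l, ⟨hl, hlW⟩, rfl⟩, rfl⟩
    exact ⟨l + s, ⟨add_mem hl hs, l.2, hlW, rfl⟩, rfl⟩

theorem modelSet_inter_ball (W : Set F) (c : E) (ρ : ℝ) :
    modelSet Λ W ∩ Metric.ball c ρ = Prod.fst '' (Metric.ball c ρ ×ˢ W ∩ Λ) := by
  ext x
  constructor
  · rintro ⟨⟨l, ⟨hl, hlW⟩, rfl⟩, hlc⟩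
    exact ⟨l, ⟨⟨hlc, hlW⟩, hl⟩, rfl⟩
  · rintro ⟨l, ⟨⟨hlc, hlW⟩, hl⟩, rfl⟩
    exact ⟨⟨l, ⟨hl, hlW⟩, rfl⟩, hlc⟩

theorem ballCount_modelSet (hinj : Set.InjOn Prod.fst (Λ : Set (E × F))) (W : Set F) (c : E)
    (ρ : ℝ) : ballCount (modelSet Λ W) c ρ = (Metric.ball c ρ ×ˢ W ∩ Λ).ncard := by
  rw [ballCount, modelSet_inter_ball,
    (hinj.mono Set.inter_subset_right).ncard_image]

theorem ballCount_modelSet_union [ProperSpace E] [ProperSpace F] [DiscreteTopology Λ]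
    (hinj : Set.InjOn Prod.fst (Λ : Set (E × F))) {W W' : Set F} (hW : Bornology.IsBounded W)
    (hW' : Bornology.IsBounded W') (hdisj : Disjoint W W') (c : E) (ρ : ℝ) :
    ballCount (modelSet Λ (W ∪ W')) c ρ =
      ballCount (modelSet Λ W) c ρ + ballCount (modelSet Λ W') c ρ := by
  simp only [ballCount_modelSet hinj]
  rw [Set.prod_union, Set.union_inter_distrib_right, Set.ncard_union_eq _
    (finite_inter_of_isBounded Λ (Metric.isBounded_ball.prod hW))
    (finite_inter_of_isBounded Λ (Metric.isBounded_ball.prod hW'))]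
  exact (Set.Disjoint.set_prod_right hdisj _ _).mono Set.inter_subset_left Set.inter_subset_left

end Windows

theorem dist_sub_nsmul_le (c y : E) {k K : ℕ} (h : k ≤ K) : dist c (c - k • y) ≤ K * ‖y‖ := by
  rw [dist_self_sub_right]
  exact norm_nsmul_le.trans (by gcongr)

theorem mem_ball_prod_Ico_of_dist_le {c : E} {ρ α β D : ℝ} {u v : E × ℝ}
    (hu : u ∈ Metric.ball c ρ ×ˢ Set.Ico α β) (huv : dist v u ≤ D) :
    v ∈ Metric.ball c (ρ + D) ×ˢ Set.Ico (α - D) (β + D) := by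
  obtain ⟨hfst, hsnd⟩ := max_le_iff.1 (Prod.dist_eq.symm.trans_le huv)
  obtain ⟨huc, hα, hβ⟩ := hu
  rw [Real.dist_eq, abs_le] at hsnd
  refine ⟨?_, by linarith, by linarith⟩
  exact Metric.mem_ball.2 (by linarith [dist_triangle v.1 u.1 c, Metric.mem_ball.1 huc])

variable {Λ : Submodule ℤ (E × ℝ)} [ProperSpace E] [DiscreteTopology Λ]

theorem ballCount_modelSet_Ico_nsmul (hinj : Set.InjOn Prod.fst (Λ : Set (E × ℝ))) {s : E × ℝ}
    (hs : s ∈ Λ) (hpos : 0 ≤ s.2) (α : ℝ) (K : ℕ) (c : E) (ρ : ℝ) :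
    ballCount (modelSet Λ (Set.Ico α (α + K * s.2))) c ρ =
      ∑ k ∈ Finset.range K, ballCount (modelSet Λ (Set.Ico α (α + s.2))) (c - k • s.1) ρ := by
  induction K with
  | zero => simp [ballCount, modelSet]
  | succ K ih =>
    have hshift : Set.Ico (α + K * s.2) (α + (K + 1 : ℕ) * s.2) =
        (fun h => h + (K • s).2) '' Set.Ico α (α + s.2) := by
      rw [Set.image_add_const_Ico, Prod.smul_snd, nsmul_eq_mul]
      push_cast
      ring_nf
    have hle : (K : ℝ) * s.2 ≤ (K + 1 : ℕ) * s.2 := by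
      gcongr
      exact K.le_succ
    rw [Finset.sum_range_succ, ← ih, ← Set.Ico_union_Ico_eq_Ico (b := α + K * s.2)
      (le_add_of_nonneg_right (by positivity)) (by gcongr),
      ballCount_modelSet_union hinj (Metric.isBounded_Ico _ _) (Metric.isBounded_Ico _ _)
        Set.Ico_disjoint_Ico_same, hshift, modelSet_image_add_right (nsmul_mem hs K),
      ballCount_image_add_right, Prod.smul_fst]

theorem mul_ballCount_modelSet_Ico_le (hinj : Set.InjOn Prod.fst (Λ : Set (E × ℝ))) {s : E × ℝ}
    (hs : s ∈ Λ) (hpos : 0 ≤ s.2) (α : ℝ) (K : ℕ) (c : E) (ρ : ℝ) :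
    K * ballCount (modelSet Λ (Set.Ico α (α + s.2))) c ρ ≤
      ballCount (modelSet Λ (Set.Ico α (α + K * s.2))) c (ρ + K * ‖s.1‖) := by
  rw [ballCount_modelSet_Ico_nsmul hinj hs hpos, ← smul_eq_mul]
  conv_lhs => rw [← Finset.card_range K]
  refine Finset.card_nsmul_le_sum _ _ _ fun k hk => ballCount_le_ballCount
    (finite_modelSet_inter_ball (Metric.isBounded_Ico _ _) _ _) ?_
  gcongr
  exact dist_sub_nsmul_le c s.1 (Finset.mem_range.1 hk).le

theorem ballCount_modelSet_Ico_le_mul (hinj : Set.InjOn Prod.fst (Λ : Set (E × ℝ))) {s : E × ℝ}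
    (hs : s ∈ Λ) (hpos : 0 ≤ s.2) (α : ℝ) (K : ℕ) (c : E) (ρ : ℝ) :
    ballCount (modelSet Λ (Set.Ico α (α + K * s.2))) c ρ ≤
      K * ballCount (modelSet Λ (Set.Ico α (α + s.2))) c (ρ + K * ‖s.1‖) := by
  rw [ballCount_modelSet_Ico_nsmul hinj hs hpos]
  refine (Finset.sum_le_card_nsmul _ _ _ fun k hk => ballCount_le_ballCount
    (finite_modelSet_inter_ball (Metric.isBounded_Ico _ _) c (ρ + K * ‖s.1‖)) ?_).trans_eq
      (by rw [Finset.card_range, smul_eq_mul])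
  gcongr
  rw [dist_comm]
  exact dist_sub_nsmul_le c s.1 (Finset.mem_range.1 hk).le

theorem ballCount_modelSet_Ico_mono {α β β' : ℝ} (h : β ≤ β') (c : E) (ρ : ℝ) :
    ballCount (modelSet Λ (Set.Ico α β)) c ρ ≤ ballCount (modelSet Λ (Set.Ico α β')) c ρ :=
  Set.ncard_le_ncard
    (Set.inter_subset_inter_left _ (modelSet_mono (Set.Ico_subset_Ico_right h)))
    (finite_modelSet_inter_ball (Metric.isBounded_Ico _ _) c ρ)

variable [NormedSpace ℝ E] [MeasurableSpace E] [BorelSpace E] (μ : Measure E)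
  [μ.IsAddHaarMeasure] [IsZLattice ℝ Λ]

theorem exists_ballCount_modelSet_bounds (hinj : Set.InjOn Prod.fst (Λ : Set (E × ℝ))) :
    ∃ D > 0, ∀ α β, α ≤ β → ∀ c ρ,
      (β - α - 2 * D) * μ.real (Metric.ball (0 : E) (ρ - D)) ≤
        ballCount (modelSet Λ (Set.Ico α β)) c ρ * ZLattice.covolume Λ (μ.prod volume) ∧
      ballCount (modelSet Λ (Set.Ico α β)) c ρ * ZLattice.covolume Λ (μ.prod volume) ≤
        (β - α + 2 * D) * μ.real (Metric.ball (0 : E) (ρ + D)) := by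
  have := FiniteDimensional.of_locallyCompactSpace ℝ (E := E)
  obtain ⟨D, hD, hcard⟩ := exists_card_mul_covolume_bounds Λ (μ.prod volume)
  have hvol (c : E) (ρ α β : ℝ) : (μ.prod volume).real (Metric.ball c ρ ×ˢ Set.Ico α β) =
      max (β - α) 0 * μ.real (Metric.ball (0 : E) ρ) := by
    rw [measureReal_prod_prod, Real.volume_real_Ico, Measure.addHaar_real_ball_center, mul_comm]
  have hfin (c : E) (ρ α β : ℝ) : (μ.prod volume) (Metric.ball c ρ ×ˢ Set.Ico α β) ≠ ⊤ :=
    (Metric.isBounded_ball.prod (Metric.isBounded_Ico _ _)).measure_lt_top.ne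
  refine ⟨D, hD, fun α β hαβ c ρ => ?_⟩
  have hA := finite_inter_of_isBounded Λ
    ((Metric.isBounded_ball (x := c) (r := ρ)).prod (Metric.isBounded_Ico α β))
  have hAΛ : (hA.toFinset : Set (E × ℝ)) ⊆ Λ := by simp
  rw [ballCount_modelSet hinj, Set.ncard_eq_toFinset_card _ hA]
  constructor
  · refine le_trans ?_ ((hcard _ _ hAΛ (hfin c (ρ - D) (α + D) (β - D))).2 ?_)
    · rw [hvol]
      gcongr
      exact le_max_of_le_left (by linarith)
    · rintro v hv ⟨u, hvu, hu⟩
      have hv' := mem_ball_prod_Ico_of_dist_le hu (Metric.mem_closedBall'.1 hvu)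
      rw [sub_add_cancel, add_sub_cancel_right, sub_add_cancel] at hv'
      exact hA.mem_toFinset.2 ⟨hv', hv⟩
  · refine ((hcard _ _ hAΛ (hfin c (ρ + D) (α - D) (β + D))).1 fun v hv u hu => ?_).trans_eq ?_
    · exact mem_ball_prod_Ico_of_dist_le (hA.mem_toFinset.1 hv).1 (Metric.mem_closedBall.1 hu)
    · rw [hvol, max_eq_left (by linarith)]
      ring

theorem exists_le_ballCount_modelSet_Ico_add (hinj : Set.InjOn Prod.fst (Λ : Set (E × ℝ)))
    {s : E × ℝ} (hs : s ∈ Λ) (hpos : 0 < s.2) {ε : ℝ} (hε : 0 < ε) : ∃ d, ∀ α c ρ,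
      (s.2 - ε) * μ.real (Metric.ball (0 : E) (ρ + d)) ≤
        ballCount (modelSet Λ (Set.Ico α (α + s.2))) c ρ * ZLattice.covolume Λ (μ.prod volume) := by
  obtain ⟨D, hD, hbound⟩ := exists_ballCount_modelSet_bounds μ hinj
  obtain ⟨K, hK⟩ := exists_nat_gt (2 * D / ε)
  have hK0 : (0 : ℝ) < K := (by positivity : 0 < 2 * D / ε).trans hK
  rw [div_lt_iff₀ hε] at hK
  have hκ0 : 0 ≤ ZLattice.covolume Λ (μ.prod volume) := ENNReal.toReal_nonneg
  refine ⟨-(K * ‖s.1‖) - D, fun α c ρ => le_of_mul_le_mul_left ?_ hK0⟩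
  have hcut : (ballCount (modelSet Λ (Set.Ico α (α + K * s.2))) c (ρ - K * ‖s.1‖) : ℝ) ≤
      K * ballCount (modelSet Λ (Set.Ico α (α + s.2))) c ρ := by
    have := ballCount_modelSet_Ico_le_mul hinj hs hpos.le α K c (ρ - K * ‖s.1‖)
    rw [sub_add_cancel] at this
    exact_mod_cast this
  calc K * ((s.2 - ε) * μ.real (Metric.ball (0 : E) (ρ + (-(K * ‖s.1‖) - D))))
    _ = (K * s.2 - K * ε) * μ.real (Metric.ball (0 : E) (ρ - K * ‖s.1‖ - D)) := by ring_nf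
    _ ≤ (α + K * s.2 - α - 2 * D) * μ.real (Metric.ball (0 : E) (ρ - K * ‖s.1‖ - D)) :=
      mul_le_mul_of_nonneg_right (by linarith) measureReal_nonneg
    _ ≤ _ := (hbound α _ (le_add_of_nonneg_right (by positivity)) c _).1
    _ ≤ _ := mul_le_mul_of_nonneg_right hcut hκ0
    _ = _ := mul_assoc _ _ _

theorem exists_ballCount_modelSet_Ico_add_le (hinj : Set.InjOn Prod.fst (Λ : Set (E × ℝ)))
    {s : E × ℝ} (hs : s ∈ Λ) (hpos : 0 < s.2) {ε : ℝ} (hε : 0 < ε) : ∃ d, ∀ α c ρ,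
      ballCount (modelSet Λ (Set.Ico α (α + s.2))) c ρ * ZLattice.covolume Λ (μ.prod volume) ≤
        (s.2 + ε) * μ.real (Metric.ball (0 : E) (ρ + d)) := by
  obtain ⟨D, hD, hbound⟩ := exists_ballCount_modelSet_bounds μ hinj
  obtain ⟨K, hK⟩ := exists_nat_gt (2 * D / ε)
  have hK0 : (0 : ℝ) < K := (by positivity : 0 < 2 * D / ε).trans hK
  rw [div_lt_iff₀ hε] at hK
  have hκ0 : 0 ≤ ZLattice.covolume Λ (μ.prod volume) := ENNReal.toReal_nonneg
  refine ⟨K * ‖s.1‖ + D, fun α c ρ => le_of_mul_le_mul_left ?_ hK0⟩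
  have hcut : (K * ballCount (modelSet Λ (Set.Ico α (α + s.2))) c ρ : ℝ) ≤
      ballCount (modelSet Λ (Set.Ico α (α + K * s.2))) c (ρ + K * ‖s.1‖) := by
    exact_mod_cast mul_ballCount_modelSet_Ico_le hinj hs hpos.le α K c ρ
  rw [← mul_assoc]
  calc _
    _ ≤ _ := mul_le_mul_of_nonneg_right hcut hκ0
    _ ≤ (α + K * s.2 - α + 2 * D) * μ.real (Metric.ball (0 : E) (ρ + K * ‖s.1‖ + D)) :=
      (hbound α _ (le_add_of_nonneg_right (by positivity)) c _).2
    _ ≤ (K * s.2 + K * ε) * μ.real (Metric.ball (0 : E) (ρ + K * ‖s.1‖ + D)) :=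
      mul_le_mul_of_nonneg_right (by linarith) measureReal_nonneg
    _ = K * ((s.2 + ε) * μ.real (Metric.ball (0 : E) (ρ + (K * ‖s.1‖ + D)))) := by ring_nf

theorem hasUniformDensity_modelSet_Ico (hinj : Set.InjOn Prod.fst (Λ : Set (E × ℝ)))
    (hdense : Dense (Prod.snd '' (Λ : Set (E × ℝ)))) {α β : ℝ} (hαβ : α < β) :
    HasUniformDensity μ (modelSet Λ (Set.Ico α β))
      ((β - α) / ZLattice.covolume Λ (μ.prod volume)) := by
  have := FiniteDimensional.of_locallyCompactSpace ℝ (E := E)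
  set κ := ZLattice.covolume Λ (μ.prod volume)
  have hκ0 : 0 < κ := ZLattice.covolume_pos Λ _
  refine hasUniformDensity_of_le (fun ε hε => ?_) fun ε hε => ?_
  · have hδ : 0 < ε * κ / 2 := by positivity
    obtain ⟨_, ⟨s, hs, rfl⟩, hlow, hhigh⟩ :=
      hdense.exists_between (max_lt (sub_pos.2 hαβ) (sub_lt_self (β - α) hδ))
    obtain ⟨hpos, hlow⟩ := max_lt_iff.1 hlow
    obtain ⟨d, hd⟩ := exists_le_ballCount_modelSet_Ico_add μ hinj hs hpos hδ
    refine ⟨d, fun c ρ => le_of_mul_le_mul_right ?_ hκ0⟩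
    calc ((β - α) / κ - ε) * μ.real (Metric.ball (0 : E) (ρ + d)) * κ
      _ = (β - α - ε * κ) * μ.real (Metric.ball (0 : E) (ρ + d)) := by field_simp
      _ ≤ (s.2 - ε * κ / 2) * μ.real (Metric.ball (0 : E) (ρ + d)) :=
        mul_le_mul_of_nonneg_right (by linarith) measureReal_nonneg
      _ ≤ ballCount (modelSet Λ (Set.Ico α (α + s.2))) c ρ * κ := hd α c ρ
      _ ≤ _ := by
        gcongr
        exact ballCount_modelSet_Ico_mono (by linarith) c ρ
  · have hδ : 0 < ε * κ / 2 := by positivity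
    obtain ⟨_, ⟨s, hs, rfl⟩, hlow, hhigh⟩ :=
      hdense.exists_between (lt_add_of_pos_right (β - α) hδ)
    obtain ⟨d, hd⟩ :=
      exists_ballCount_modelSet_Ico_add_le μ hinj hs ((sub_pos.2 hαβ).trans hlow) hδ
    refine ⟨d, fun c ρ => le_of_mul_le_mul_right ?_ hκ0⟩
    calc ballCount (modelSet Λ (Set.Ico α β)) c ρ * κ
      _ ≤ ballCount (modelSet Λ (Set.Ico α (α + s.2))) c ρ * κ := by
        gcongr
        exact ballCount_modelSet_Ico_mono (by linarith) c ρ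
      _ ≤ (s.2 + ε * κ / 2) * μ.real (Metric.ball (0 : E) (ρ + d)) := hd α c ρ
      _ ≤ (β - α + ε * κ) * μ.real (Metric.ball (0 : E) (ρ + d)) :=
        mul_le_mul_of_nonneg_right (by linarith) measureReal_nonneg
      _ = _ := by field_simp

end Equidistribution

section CutAndProject

theorem repetitivity_lt_top_of_finite {E : Type*} [NormedAddCommGroup E] {X : Set E} {T : ℝ}
    (hfin : (patchClass X T '' X).Finite)
    (h : ∀ x ∈ X, ∃ R : ℝ, ∀ c, ∃ y ∈ patchClass X T x, dist c y ≤ R) : repetitivity X T < ⊤ := by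
  have hclass : ∀ A ∈ patchClass X T '' X, ∃ R : ℝ, ∀ c, ∃ y ∈ A, dist c y ≤ R :=
    Set.forall_mem_image.2 h
  choose! R hR using hclass
  obtain ⟨M, hM⟩ := (hfin.image R).bddAbove
  refine (repetitivity_le_ofReal fun c x hx => ?_).trans_lt (ENNReal.ofReal_lt_top (r := M))
  have hA : patchClass X T x ∈ patchClass X T '' X := ⟨x, hx, rfl⟩
  obtain ⟨y, hy, hcy⟩ := hR _ hA c
  exact ⟨y, hy, (dist_comm y c).trans_le (hcy.trans (hM ⟨_, hA, rfl⟩))⟩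

variable {E : Type*} [NormedAddCommGroup E] [NormedSpace ℝ E] [FiniteDimensional ℝ E]
  {Λ : Submodule ℤ (E × ℝ)} [DiscreteTopology Λ]

theorem exists_patchClass_modelSet_Ico_eq (hinj : Set.InjOn Prod.fst (Λ : Set (E × ℝ)))
    {a b : ℝ} {x : E} (hx : x ∈ modelSet Λ (Set.Ico a b)) (T : ℝ) : ∃ α β, α < β ∧
      patchClass (modelSet Λ (Set.Ico a b)) T x = modelSet Λ (Set.Ico α β) := by
  obtain ⟨l, ⟨hl, hlW⟩, rfl⟩ := hx
  obtain ⟨α, β, hαβ, hsub⟩ := exists_subwindow_Ico_eq hlW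
    (finite_patchHeights (Λ := Λ) (T := T) (Metric.isBounded_Ico a b))
  exact ⟨α, β, hαβ, by rw [patchClass_modelSet hinj hl hlW, hsub]⟩

variable [IsZLattice ℝ Λ]

theorem exists_mem_modelSet_Ico_dist_le (hinj : Set.InjOn Prod.fst (Λ : Set (E × ℝ)))
    (hdense : Dense (Prod.snd '' (Λ : Set (E × ℝ)))) {α β : ℝ} (hαβ : α < β) :
    ∃ R : ℝ, ∀ c, ∃ y ∈ modelSet Λ (Set.Ico α β), dist c y ≤ R := by
  borelize E
  exact (hasUniformDensity_modelSet_Ico Measure.addHaar hinj hdense hαβ).exists_mem_dist_le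
    (div_pos (sub_pos.2 hαβ) (ZLattice.covolume_pos Λ _))

theorem isRepetitive_modelSet_Ico (hinj : Set.InjOn Prod.fst (Λ : Set (E × ℝ)))
    (hdense : Dense (Prod.snd '' (Λ : Set (E × ℝ)))) (a b : ℝ) :
    IsRepetitive (modelSet Λ (Set.Ico a b)) := by
  intro T _
  refine repetitivity_lt_top_of_finite
    (finite_patchClass_image_modelSet hinj (Metric.isBounded_Ico a b)) fun x hx => ?_
  obtain ⟨α, β, hαβ, heq⟩ := exists_patchClass_modelSet_Ico_eq hinj hx T
  rw [heq]
  exact exists_mem_modelSet_Ico_dist_le hinj hdense hαβ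

theorem hasUniformPatchFrequencies_modelSet_Ico {E : Type*} [NormedAddCommGroup E]
    [NormedSpace ℝ E] [FiniteDimensional ℝ E] [MeasureSpace E] [BorelSpace E]
    [(volume : Measure E).IsAddHaarMeasure] {Λ : Submodule ℤ (E × ℝ)} [DiscreteTopology Λ]
    [IsZLattice ℝ Λ] (hinj : Set.InjOn Prod.fst (Λ : Set (E × ℝ)))
    (hdense : Dense (Prod.snd '' (Λ : Set (E × ℝ)))) (a b : ℝ) :
    HasUniformPatchFrequencies (modelSet Λ (Set.Ico a b)) := by
  intro T _ x hx
  obtain ⟨α, β, hαβ, heq⟩ := exists_patchClass_modelSet_Ico_eq hinj hx T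
  rw [heq]
  exact ⟨_, hasUniformDensity_modelSet_Ico volume hinj hdense hαβ⟩

end CutAndProject

section PerturbedLattice

theorem exists_rationally_independent_reals (ι : Type*) [Fintype ι] :
    ∃ α : ι → ℝ, ∀ (c : ι → ℤ) (m : ℤ), ∑ i, c i * α i = m → c = 0 := by
  let e := Fintype.equivFin ι
  obtain ⟨τ, hτ⟩ : ∃ τ : ℝ, Transcendental ℤ τ := ⟨_, transcendental_liouvilleNumber le_rfl⟩
  refine ⟨fun i => τ ^ ((e i : ℕ) + 1), fun c m h => funext fun i => ?_⟩
  set p : Polynomial ℤ :=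
    ∑ i, Polynomial.monomial ((e i : ℕ) + 1) (c i) - Polynomial.C m with hp
  have hp0 : p = 0 := by
    by_contra hne
    exact hτ ⟨p, hne, by simp [hp, Polynomial.aeval_monomial, h]⟩
  have hcoeff : p.coeff ((e i : ℕ) + 1) = c i := by
    rw [hp, Polynomial.coeff_sub, Polynomial.finsetSum_coeff,
      Polynomial.coeff_C_of_ne_zero (Nat.succ_ne_zero _), sub_zero,
      Finset.sum_eq_single_of_mem i (Finset.mem_univ i), Polynomial.coeff_monomial_same]
    intro j _ hji
    exact Polynomial.coeff_monomial_of_ne _ (by simpa [Fin.val_inj] using hji.symm)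
  rw [← hcoeff, hp0, Polynomial.coeff_zero, Pi.zero_apply]

theorem exists_linearMap_eq_intCast_imp_eq_zero {E ι : Type*} [AddCommGroup E] [Module ℝ E]
    [Finite ι] (b : Module.Basis ι ℝ E) :
    ∃ φ : E →ₗ[ℝ] ℝ, ∀ v ∈ Submodule.span ℤ (Set.range b), ∀ m : ℤ, φ v = m → v = 0 := by
  have := Fintype.ofFinite ι
  obtain ⟨α, hα⟩ := exists_rationally_independent_reals ι
  refine ⟨b.constr ℝ α, fun v hv m hm => ?_⟩
  choose c hc using (b.mem_span_iff_repr_mem ℤ v).1 hv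
  replace hc i : b.repr v i = c i := (hc i).symm
  have hc0 : c = 0 := hα c m (by rw [← hm, Module.Basis.constr_apply_fintype]; simp [hc])
  exact b.ext_elem fun i => by simp [hc, hc0]

theorem span_int_range_basis_prod {R V W ι κ : Type*} [Ring R] [AddCommGroup V] [AddCommGroup W]
    [Module R V] [Module R W] (b : Module.Basis ι R V) (c : Module.Basis κ R W) :
    Submodule.span ℤ (Set.range (b.prod c)) =
      (Submodule.span ℤ (Set.range b)).prod (Submodule.span ℤ (Set.range c)) := by
  rw [← LinearMap.span_inl_union_inr, ← Set.range_comp, ← Set.range_comp, ← Set.Sum.elim_range]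
  congr 2
  exact funext (b.prod_apply c)

theorem isLattice_span_range {V ι : Type*} [NormedAddCommGroup V] [NormedSpace ℝ V] [Finite ι]
    (b : Module.Basis ι ℝ V) : IsLattice (Submodule.span ℤ (Set.range b)) :=
  have := Fintype.ofFinite ι
  ⟨inferInstance, inferInstance⟩

theorem dense_image_snd_of_injOn {E : Type*} [NormedAddCommGroup E] [NormedSpace ℝ E]
    [Nontrivial E] {Λ : Submodule ℤ (E × ℝ)} [DiscreteTopology Λ] [IsZLattice ℝ Λ]
    (hsnd : Set.InjOn Prod.snd (Λ : Set (E × ℝ))) : Dense (Prod.snd '' (Λ : Set (E × ℝ))) := by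
  let S : AddSubgroup ℝ := Λ.toAddSubgroup.map (AddMonoidHom.snd E ℝ)
  refine S.dense_or_cyclic.resolve_right ?_
  rintro ⟨a, ha⟩
  rw [← AddSubgroup.zmultiples_eq_closure] at ha
  obtain ⟨l, hl, rfl⟩ : a ∈ S := ha ▸ AddSubgroup.mem_zmultiples a
  have hline : (Λ : Set (E × ℝ)) ⊆ Submodule.span ℝ {l} := by
    intro k hk
    obtain ⟨m, hm⟩ : k.2 ∈ AddSubgroup.zmultiples l.2 := ha ▸ ⟨k, hk, rfl⟩
    have hkl : m • l = k := hsnd (Λ.smul_mem m hl) hk hm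
    rw [← hkl]
    exact zsmul_mem (Submodule.mem_span_singleton_self l) m
  have htop : Submodule.span ℝ {l} = ⊤ :=
    top_le_iff.1 ((IsZLattice.span_top (K := ℝ) (L := Λ)).ge.trans (Submodule.span_le.2 hline))
  have hmem (k : E × ℝ) : ∃ c : ℝ, c • l = k :=
    Submodule.mem_span_singleton.1 (htop ▸ Submodule.mem_top)
  obtain ⟨v, hv⟩ := exists_ne (0 : E)
  obtain ⟨c, hc⟩ := hmem (v, 0)
  obtain ⟨d, hd⟩ := hmem (0, 1)
  have hl1 : l.1 = 0 := (smul_eq_zero.1 (congrArg Prod.fst hd)).resolve_left fun hd0 =>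
    one_ne_zero (α := ℝ) (by simpa [hd0] using (congrArg Prod.snd hd).symm)
  exact hv (by simpa [hl1] using (congrArg Prod.fst hc).symm)

variable {E : Type*} [NormedAddCommGroup E] [NormedSpace ℝ E]

/-- The displacement `v ↦ v + ⟨φ v⟩ δ` that defines a perturbed lattice. -/
noncomputable def perturb (φ : E →ₗ[ℝ] ℝ) (δ v : E) : E := v + Int.fract (φ v) • δ

/-- The shear of `E × ℝ` that maps `L × ℤ` to the lattice which defines the perturbed lattice as a
cut-and-project set. -/
def shear (φ : E →ₗ[ℝ] ℝ) (δ : E) : (E × ℝ) ≃ₗ[ℝ] (E × ℝ) where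
  toFun p := (p.1 + (φ p.1 + p.2) • δ, φ p.1 + p.2)
  invFun p := (p.1 - p.2 • δ, p.2 - φ (p.1 - p.2 • δ))
  map_add' p q := by
    ext
    · simp only [Prod.fst_add, Prod.snd_add, map_add]
      module
    · simp only [Prod.fst_add, Prod.snd_add, map_add]
      ring
  map_smul' c p := by
    ext
    · simp only [Prod.smul_fst, Prod.smul_snd, map_smul, RingHom.id_apply, smul_eq_mul]
      module
    · simp only [Prod.smul_fst, Prod.smul_snd, map_smul, RingHom.id_apply, smul_eq_mul]
      ring
  left_inv p := by simp
  right_inv p := by simp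

/-- The lattice of the vectors `(v + (φ v + m) δ, φ v + m)` with `v ∈ L` and `m ∈ ℤ`. Those with
height in `[0, 1)` are the `(v + ⟨φ v⟩ δ, ⟨φ v⟩)`, which project to the perturbed lattice. -/
def shearedLattice (L : Submodule ℤ E) (φ : E →ₗ[ℝ] ℝ) (δ : E) : Submodule ℤ (E × ℝ) :=
  (L.prod (Submodule.span ℤ {1})).map ((shear φ δ).toLinearMap.restrictScalars ℤ)

variable {L : Submodule ℤ E} {φ : E →ₗ[ℝ] ℝ} {δ : E}

theorem dist_perturb_le (v : E) : dist (perturb φ δ v) v ≤ ‖δ‖ := by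
  rw [dist_eq_norm, perturb, add_sub_cancel_left, norm_smul,
    Real.norm_of_nonneg (Int.fract_nonneg _)]
  exact mul_le_of_le_one_left (norm_nonneg δ) (Int.fract_lt_one _).le

theorem mem_shearedLattice_iff {l : E × ℝ} : l ∈ shearedLattice L φ δ ↔
    ∃ v ∈ L, ∃ m : ℤ, (v + (φ v + m) • δ, φ v + m) = l := by
  simp only [shearedLattice, Submodule.mem_map, Submodule.mem_prod, Submodule.mem_span_singleton,
    zsmul_one, Prod.exists]
  constructor
  · rintro ⟨v, _, ⟨hv, m, rfl⟩, rfl⟩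
    exact ⟨v, hv, m, rfl⟩
  · rintro ⟨v, hv, m, rfl⟩
    exact ⟨v, m, ⟨hv, m, rfl⟩, rfl⟩

theorem isLattice_shearedLattice [FiniteDimensional ℝ E] (hL : IsLattice L) :
    IsLattice (shearedLattice L φ δ) := by
  obtain ⟨_, _⟩ := hL
  obtain ⟨b, rfl⟩ := exists_basis L
  have hspan : shearedLattice (Submodule.span ℤ (Set.range b)) φ δ = Submodule.span ℤ (Set.range
      ((b.prod (Module.Basis.singleton Unit ℝ)).map (shear φ δ))) := by
    rw [← ZSpan.map, span_int_range_basis_prod, Module.Basis.coe_singleton, Pi.one_def,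
      Set.range_const]
    rfl
  rw [hspan]
  exact isLattice_span_range _

theorem image_perturb_eq_modelSet :
    perturb φ δ '' (L : Set E) = modelSet (shearedLattice L φ δ) (Set.Ico 0 1) := by
  ext x
  constructor
  · rintro ⟨v, hv, rfl⟩
    refine ⟨(perturb φ δ v, Int.fract (φ v)), ⟨mem_shearedLattice_iff.2 ⟨v, hv, -⌊φ v⌋, ?_⟩,
      Int.fract_nonneg _, Int.fract_lt_one _⟩, rfl⟩
    rw [Int.cast_neg, ← sub_eq_add_neg, Int.self_sub_floor, perturb]
  · rintro ⟨_, ⟨hl, h0, h1⟩, rfl⟩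
    obtain ⟨v, hv, m, rfl⟩ := mem_shearedLattice_iff.1 hl
    have hfract : Int.fract (φ v) = φ v + m :=
      Int.fract_eq_iff.2 ⟨h0, h1, -m, by rw [Int.cast_neg]; ring⟩
    exact ⟨v, hv, by rw [perturb, hfract]⟩

theorem injOn_snd_shearedLattice (hφ : ∀ v ∈ L, ∀ m : ℤ, φ v = m → v = 0) :
    Set.InjOn Prod.snd (shearedLattice L φ δ : Set (E × ℝ)) := by
  intro l hl k hk hlk
  rw [← sub_eq_zero]
  obtain ⟨v, hv, m, hvm⟩ := mem_shearedLattice_iff.1 (sub_mem hl hk)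
  have hheight : φ v + m = 0 := (congrArg Prod.snd hvm).trans (sub_eq_zero.2 hlk)
  have hv0 : v = 0 := hφ v hv (-m) (by rw [Int.cast_neg]; linarith)
  rw [← hvm, hheight, hv0, zero_smul, add_zero, Prod.mk_zero_zero]

theorem injOn_fst_shearedLattice {ι : Type*} (b : Module.Basis ι ℝ E)
    (hφ : ∀ v ∈ Submodule.span ℤ (Set.range b), ∀ m : ℤ, φ v = m → v = 0) (i : ι) {N : ℕ}
    (hN : N ≠ 0) : Set.InjOn Prod.fst
      (shearedLattice (Submodule.span ℤ (Set.range b)) φ ((N : ℝ)⁻¹ • b i) : Set (E × ℝ)) := by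
  intro l hl k hk hlk
  rw [← sub_eq_zero]
  obtain ⟨v, hv, m, hvm⟩ := mem_shearedLattice_iff.1 (sub_mem hl hk)
  have hfst : v + (φ v + m) • (N : ℝ)⁻¹ • b i = 0 :=
    (congrArg Prod.fst hvm).trans (sub_eq_zero.2 hlk)
  -- Comparing `i`-th coordinates shows that `φ v` is an integer, whence `v = 0`.
  obtain ⟨c, hc⟩ := (b.mem_span_iff_repr_mem ℤ v).1 hv i
  replace hc : b.repr v i = c := hc.symm
  have hcoord : (c : ℝ) + (φ v + m) * (N : ℝ)⁻¹ = 0 := by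
    simpa [hc] using congrArg (fun w => b.repr w i) hfst
  have hv0 : v = 0 := hφ v hv (-(N * c) - m) (by
    field_simp at hcoord
    push_cast
    linarith)
  have hm : (m : ℝ) = 0 := by
    simpa [hv0, hN, b.ne_zero i] using hfst
  rw [← hvm, hv0, hm, map_zero, add_zero, zero_smul, add_zero, Prod.mk_zero_zero]

theorem exists_injOn_shearedLattice [FiniteDimensional ℝ E] [Nontrivial E] (hL : IsLattice L)
    {η : ℝ} (hη : 0 < η) : ∃ (φ : E →ₗ[ℝ] ℝ) (δ : E), ‖δ‖ ≤ η ∧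
      Set.InjOn Prod.fst (shearedLattice L φ δ : Set (E × ℝ)) ∧
      Set.InjOn Prod.snd (shearedLattice L φ δ : Set (E × ℝ)) := by
  obtain ⟨_, _⟩ := hL
  obtain ⟨b, rfl⟩ := exists_basis L
  let i : Fin (Module.finrank ℝ E) := ⟨0, Module.finrank_pos⟩
  obtain ⟨φ, hφ⟩ := exists_linearMap_eq_intCast_imp_eq_zero b
  obtain ⟨N, hN⟩ := exists_nat_gt (‖b i‖ / η)
  have hN0 : (0 : ℝ) < N := (div_nonneg (norm_nonneg _) hη.le).trans_lt hN
  refine ⟨φ, (N : ℝ)⁻¹ • b i, ?_, injOn_fst_shearedLattice b hφ i (Nat.cast_pos.1 hN0).ne',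
    injOn_snd_shearedLattice hφ⟩
  rw [norm_smul, norm_inv, RCLike.norm_natCast, inv_mul_le_iff₀ hN0]
  exact ((div_lt_iff₀ hη).1 hN).le

end PerturbedLattice

section Constants

variable {E : Type*} [NormedAddCommGroup E] [NormedSpace ℝ E] [FiniteDimensional ℝ E]

theorem exists_perturbedLattice [Nontrivial E] [MeasureSpace E] [BorelSpace E]
    [(volume : Measure E).IsAddHaarMeasure] {L : Submodule ℤ E} (hL : IsLattice L) {k : ℝ}
    (hk : packingCoveringRatio (L : Set E) < k) :
    ∃ Z : Set E, packingCoveringRatio Z < k ∧ IsMeyer Z ∧ IsAperiodic Z ∧ IsRepetitive Z ∧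
      HasUniformPatchFrequencies Z ∧ IsPerturbedLattice Z ∧ IsCutAndProject Z := by
  have ⟨_, _⟩ := hL
  obtain ⟨η, hη, hratio⟩ := exists_perturbation (isDelone_coe L) hk
  obtain ⟨φ, δ, hδ, hfst, hsnd⟩ := exists_injOn_shearedLattice hL hη
  have hΛ : IsLattice (shearedLattice L φ δ) := isLattice_shearedLattice hL
  have hZ : perturb φ δ '' (L : Set E) = modelSet (shearedLattice L φ δ) (Set.Ico 0 1) :=
    image_perturb_eq_modelSet
  have ⟨_, _⟩ := hΛ
  have hdense := dense_image_snd_of_injOn hsnd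
  obtain ⟨R, hR⟩ := exists_mem_modelSet_Ico_dist_le hfst hdense one_pos
  have hne : (modelSet (shearedLattice L φ δ) (Set.Ico 0 1)).Nonempty := (hR 0).imp fun _ h => h.1
  refine ⟨modelSet (shearedLattice L φ δ) (Set.Ico 0 1),
    hZ ▸ (hratio _ fun v _ => (dist_perturb_le v).trans hδ).2,
    isMeyer_modelSet (Metric.isBounded_Ico 0 1) hR,
    isAperiodic_modelSet hfst hsnd (Metric.isBounded_Ico 0 1) hne,
    isRepetitive_modelSet_Ico hfst hdense 0 1,
    hasUniformPatchFrequencies_modelSet_Ico hfst hdense 0 1,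
    ⟨L, hL, φ, δ, hZ.symm⟩, ⟨_, hΛ, hfst, hdense, 0, 1, one_pos, rfl⟩⟩

theorem exists_isDelone_of_kappa_lt {n : ℕ} {k : ℝ} (hk : kappa n < k) :
    ∃ X : Set (EuclideanSpace ℝ (Fin n)), IsDelone X ∧ packingCoveringRatio X < k := by
  let b := Module.finBasis ℝ (EuclideanSpace ℝ (Fin n))
  obtain ⟨_, ⟨X, hX, rfl⟩, hXk⟩ := exists_lt_of_csInf_lt
    (by exact ⟨_, _, isDelone_coe (Submodule.span ℤ (Set.range b)), rfl⟩) hk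
  exact ⟨X, hX, hXk⟩

theorem exists_isLattice_of_kappaL_lt {n : ℕ} {k : ℝ} (hk : kappaL n < k) :
    ∃ L : Submodule ℤ (EuclideanSpace ℝ (Fin n)), IsLattice L ∧
      packingCoveringRatio (L : Set (EuclideanSpace ℝ (Fin n))) < k := by
  let b := Module.finBasis ℝ (EuclideanSpace ℝ (Fin n))
  obtain ⟨_, ⟨L, hL, rfl⟩, hLk⟩ := exists_lt_of_csInf_lt
    (by exact ⟨_, _, isLattice_span_range b, rfl⟩) hk
  exact ⟨L, hL, hLk⟩

end Constants

end PatchComplexity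

open PatchComplexity

theorem theorem6p3 (n : ℕ) (hn : 1 ≤ n) (ε : ℝ) (hε : 0 < ε) :
    (∃ X : Set (EuclideanSpace ℝ (Fin n)),
      Delone.IsDelone X ∧ Delone.IsAperiodic X ∧
      ∃ T : ℝ, 0 < T ∧
        (Delone.patchCount X T : ℝ≥0∞) <
          ENNReal.ofReal ((Delone.kappa n / 2 + ε) * (T / (Delone.coveringRadius X).toReal)) ∧
        Delone.repetitivity X T < ENNReal.ofReal ((Delone.kappa n / 2 + ε) * T)) ∧
    (∃ Z : Set (EuclideanSpace ℝ (Fin n)),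
      Delone.IsMeyer Z ∧ Delone.IsAperiodic Z ∧ Delone.IsRepetitive Z ∧
      Delone.HasUniformPatchFrequencies Z ∧
      Delone.IsPerturbedLattice Z ∧ Delone.IsCutAndProject Z ∧
      ∃ T : ℝ, 0 < T ∧
        (Delone.patchCount Z T : ℝ≥0∞) <
          ENNReal.ofReal ((Delone.kappaL n / 2 + ε) * (T / (Delone.coveringRadius Z).toReal)) ∧
        Delone.repetitivity Z T < ENNReal.ofReal ((Delone.kappaL n / 2 + ε) * T)) := by
  have : Nontrivial (EuclideanSpace ℝ (Fin n)) :=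
    Module.nontrivial_of_finrank_pos (R := ℝ) (by rwa [finrank_euclideanSpace_fin])
  constructor
  · obtain ⟨X, hX, hXk⟩ :=
      exists_isDelone_of_kappa_lt (show Delone.kappa n < 2 * (Delone.kappa n / 2 + ε) by linarith)
    obtain ⟨Y, hY, hYk, hYaper⟩ := exists_isAperiodic hX hXk
    exact ⟨Y, hY, hYaper, exists_patchCount_lt_and_repetitivity_lt hY hYk⟩
  · obtain ⟨L, hL, hLk⟩ :=
      exists_isLattice_of_kappaL_lt
        (show Delone.kappaL n < 2 * (Delone.kappaL n / 2 + ε) by linarith)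
    obtain ⟨Z, hZk, hmeyer, haper, hrep, hfreq, hpert, hcut⟩ := exists_perturbedLattice hL hLk
    exact ⟨Z, hmeyer, haper, hrep, hfreq, hpert, hcut,
      exists_patchCount_lt_and_repetitivity_lt hmeyer.1 hZk⟩
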